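/- Let $\lambda\in(0,1)$, let $W_n=(\lambda^n,\lambda^{n-1}]$ for $n\ge 1$ (these intervals partition $(0,1]$), and let $F_\lambda$ be the countably piecewise linear map $$F_\lambda(x)=\begin{cases}\dfrac{x-\lambda}{1-\lambda} & \text{if } x\in W_1,\\[2mm] \dfrac{x-\lambda^n}{\lambda(1-\lambda)} & \text{if } x\in W_n,\ n\ge 2,\end{cases}\qquad F_\lambda:(0,1]\to(0,1],$$ extended by $F_\lambda(0)=0$. Let $\Omega_\lambda=\{x\in[0,1]:\lim_{n\to\infty}F_\lambda^n(x)=0\}$ be the escaping set. Then its Hausdorff dimension is $$\dim_H(\Omega_\lambda)=\begin{cases}-\dfrac{\log 4}{\log[\lambda(1-\lambda)]} & \text{if } \lambda\le \tfrac12,\\[2mm] 1 & \text{if } \lambda\ge\tfrac12.\end{cases}$$ -/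

import Mathlib

open Set Filter Topology

noncomputable section

/-- The partition interval `W_n = (lam ^ n, lam ^ (n - 1)]`, used for `n ≥ 1`. -/
def partInterval (lam : ℝ) (n : ℕ) : Set ℝ := Ioc (lam ^ n) (lam ^ (n - 1))

open Classical in
/-- The countably piecewise linear map `F_lam` on `(0, 1]`: it is `(x - lam) / (1 - lam)` on `W_1`
and `(x - lam ^ n) / (lam * (1 - lam))` on `W_n` for `n ≥ 2`. For `0 < lam < 1` the intervals `W_n`
partition `(0, 1]`. The map is extended by `0` elsewhere; in particular it fixes `0`. -/
def escMap (lam x : ℝ) : ℝ :=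
  if x ∈ partInterval lam 1 then (x - lam) / (1 - lam)
  else if h : ∃ n, 2 ≤ n ∧ x ∈ partInterval lam n then
    (x - lam ^ Nat.find h) / (lam * (1 - lam))
  else 0

/-- The escaping set: the points of `[0, 1]` whose orbit under `F_lam` converges to `0`. -/
def escapingSet (lam : ℝ) : Set ℝ :=
  {x | x ∈ Icc (0 : ℝ) 1 ∧ Tendsto (fun n : ℕ => (escMap lam)^[n] x) atTop (𝓝 0)}

end

/-- The intervals `W_n`, `n ≥ 1`, are pairwise disjoint. -/
theorem partInterval_unique {lam : ℝ} (h0 : 0 < lam) (h1 : lam < 1) {x : ℝ} {m n : ℕ}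
    (hm : x ∈ partInterval lam m) (hn : x ∈ partInterval lam n) (hm1 : 1 ≤ m) (hn1 : 1 ≤ n) :
    m = n := by
  have key : ∀ a b : ℕ, x ∈ partInterval lam a → x ∈ partInterval lam b → ¬ a < b := by
    intro a b ha hb hab
    have h := pow_le_pow_of_le_one h0.le h1.le (Nat.le_sub_one_of_lt hab)
    exact absurd (lt_of_lt_of_le ha.1 hb.2) (not_lt.mpr h)
  have := key m n hm hn
  have := key n m hn hm
  omega

/-- The intervals `W_n`, `n ≥ 1`, cover `(0, 1]`. -/
theorem exists_mem_partInterval {lam : ℝ} (h0 : 0 < lam) (h1 : lam < 1) {x : ℝ}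
    (hx : x ∈ Ioc (0 : ℝ) 1) : ∃ n, 1 ≤ n ∧ x ∈ partInterval lam n := by
  obtain ⟨n, hn, hn'⟩ := exists_nat_pow_near_of_lt_one hx.1 hx.2 h0 h1
  exact ⟨n + 1, by omega, hn, hn'⟩

theorem escMap_of_mem_one {lam x : ℝ} (hx : x ∈ partInterval lam 1) :
    escMap lam x = (x - lam) / (1 - lam) := by
  simp [escMap, hx]

theorem escMap_of_mem {lam : ℝ} (h0 : 0 < lam) (h1 : lam < 1) {x : ℝ} {n : ℕ} (hn : 2 ≤ n)
    (hx : x ∈ partInterval lam n) : escMap lam x = (x - lam ^ n) / (lam * (1 - lam)) := by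
  classical
  have hx1 : x ∉ partInterval lam 1 := fun h => by
    have := partInterval_unique h0 h1 h hx le_rfl (by omega)
    omega
  have h : ∃ n, 2 ≤ n ∧ x ∈ partInterval lam n := ⟨n, hn, hx⟩
  unfold escMap
  rw [if_neg hx1, dif_pos h]
  have hs := Nat.find_spec h
  have e := partInterval_unique h0 h1 hs.2 hx (by omega) (by omega)
  exact congrArg (fun k => (x - lam ^ k) / (lam * (1 - lam))) e

/-!
Write a point of `(0, 1]` in the expansion with the two branches `1 : y ↦ lam * y` and
`0 : y ↦ lam + (1 - lam) * y`. The interval `W_n` consists of the expansions that begin with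
`1 ... 1 0`, with `n - 1` letters `1`, and the map deletes the first block `1 0` of the expansion
(or the first `0`, if the expansion starts with it). So a point escapes exactly when the excess of
the letters `1` over the letters `0` in its expansion tends to infinity.

Lower bound (`ofReal_le_dimH_escapingSet`). Concatenating arbitrary words with `a` letters `1` and
`b < a` letters `0` gives escaping points (`mul_codePoint_mem_escapingSet`). They form a homogeneous
Cantor set with `M = (a + b).choose a` pieces, whose ratio is `lam ^ a * (1 - lam) ^ b` up to a fixed
factor. An end piece put after each word keeps the pieces apart
(`le_abs_codePoint_sub_codePoint`), so the map that reads the code as a number in base `M` is Hölder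
continuous onto `[0, 1]`, and this bounds the dimension from below. Almost balanced words give every
exponent below `log 4 / -log (lam * (1 - lam))` (`exists_central_words`). If `lam > 1 / 2`, a typical
word for the Bernoulli measure with weights `lam`, `1 - lam` has a majority of letters `1`, which
gives every exponent below `1` (`exists_majority_words`).

Upper bound for `lam ≤ 1 / 2` (`dimH_escapingSet_le`). Every escaping orbit finally stays in
`(0, lam]`, and preimages under the map do not increase the dimension, so it is enough to cover the
set of points whose whole orbit is in `(0, lam]`. There, a point of `W_n` has its image in some `W_m`
with `m ≥ n - 1`, and each branch contracts by `r = lam * (1 - lam)`. If `r ^ s = 1 / 4`, the sum of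
the `s`-th powers of the diameters of the cylinders of a given depth inside `W_n` is at most a
constant multiple of `2⁻¹ ^ n`, because `1 / 4 * ∑ m ≥ n - 1, 2⁻¹ ^ m = 2⁻¹ ^ n`
(`hasCover_lowSet`). So the `s`-dimensional Hausdorff measure is finite on each piece.
-/

/-! ### Words in the two-branch expansion -/

theorem escMap_pow_succ_mul {lam : ℝ} (h0 : 0 < lam) (h1 : lam < 1) (k : ℕ) {y : ℝ}
    (hy : y ∈ Ioc (0 : ℝ) 1) :
    escMap lam (lam ^ (k + 1) * (lam + (1 - lam) * y)) = lam ^ k * y := by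
  have hl : 0 < 1 - lam := by linarith
  have hk : 0 < lam ^ (k + 1) := by positivity
  have h2 : 0 < (1 - lam) * y := mul_pos hl hy.1
  have h3 : lam + (1 - lam) * y ≤ 1 := by nlinarith [hy.2]
  rw [escMap_of_mem h0 h1 (n := k + 2) (by omega)]
  · field_simp
    ring
  · refine ⟨?_, ?_⟩
    · rw [pow_succ lam (k + 1)]
      exact mul_lt_mul_of_pos_left (by linarith) hk
    · rw [show k + 2 - 1 = k + 1 by omega]
      exact mul_le_of_le_one_right hk.le h3

theorem escMap_nonneg {lam : ℝ} (h0 : 0 < lam) (h1 : lam < 1) (x : ℝ) : 0 ≤ escMap lam x := by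
  have hl : 0 < 1 - lam := by linarith
  classical
  unfold escMap
  split_ifs with h h'
  · have := h.1
    rw [pow_one] at this
    exact div_nonneg (by linarith) hl.le
  · exact div_nonneg (by linarith [(Nat.find_spec h').2.1]) (by positivity)
  · exact le_rfl

theorem escMap_le_div_sq {lam : ℝ} (h0 : 0 < lam) (h1 : lam < 1) {x : ℝ} (hx : 0 ≤ x) :
    escMap lam x ≤ x / lam ^ 2 := by
  have hl : 0 < 1 - lam := by linarith
  classical
  unfold escMap
  split_ifs with h h'
  · have h2 := h.1
    have h3 := h.2
    norm_num at h2 h3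
    rw [div_le_div_iff₀ hl (by positivity)]
    nlinarith [mul_nonneg h0.le hl.le, mul_nonneg hx hl.le, mul_pos h0 h0]
  · obtain ⟨h2, h3⟩ := (Nat.find_spec h').2
    have h4 := (Nat.find_spec h').1
    generalize Nat.find h' = n at *
    obtain ⟨m, rfl⟩ : ∃ m, n = m + 1 := ⟨n - 1, by omega⟩
    simp only [Nat.add_sub_cancel, pow_succ] at *
    rw [div_le_div_iff₀ (by positivity) (by positivity)]
    -- since `x ≤ lam ^ m`, subtracting `lam ^ (m + 1)` removes at least the proportion `lam` of `x`
    have : x - lam ^ m * lam ≤ x * (1 - lam) := by nlinarith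
    calc (x - lam ^ m * lam) * (lam ^ 0 * lam * lam) ≤ x * (1 - lam) * (lam ^ 0 * lam * lam) := by
          gcongr
      _ ≤ x * (lam * (1 - lam)) := by
          have : 0 ≤ x * (1 - lam) * lam := by positivity
          nlinarith
  · positivity

/-- The point whose expansion is the word `w` followed by the expansion of `y`: the letter `true`
stands for the branch `y ↦ lam * y`, and `false` for `y ↦ lam + (1 - lam) * y`. -/
def wordMap (lam : ℝ) : List Bool → ℝ → ℝ
  | [], y => y
  | true :: w, y => lam * wordMap lam w y
  | false :: w, y => lam + (1 - lam) * wordMap lam w y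

/-- The contraction ratio of `wordMap lam w`. -/
def wordRatio (lam : ℝ) (w : List Bool) : ℝ :=
  lam ^ w.count true * (1 - lam) ^ w.count false

theorem wordRatio_pos {lam : ℝ} (h0 : 0 < lam) (h1 : lam < 1) (w : List Bool) :
    0 < wordRatio lam w :=
  mul_pos (pow_pos h0 _) (pow_pos (by linarith) _)

theorem wordRatio_cons_true (lam : ℝ) (w : List Bool) :
    wordRatio lam (true :: w) = lam * wordRatio lam w := by
  simp [wordRatio, pow_succ]; ring

theorem wordRatio_cons_false (lam : ℝ) (w : List Bool) :
    wordRatio lam (false :: w) = (1 - lam) * wordRatio lam w := by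
  simp [wordRatio, pow_succ]; ring

theorem wordMap_eq (lam : ℝ) (w : List Bool) (y : ℝ) :
    wordMap lam w y = wordMap lam w 0 + wordRatio lam w * y := by
  induction w with
  | nil => simp [wordMap, wordRatio]
  | cons b w ih =>
    cases b
    · rw [wordRatio_cons_false, wordMap, ih, wordMap]; ring
    · rw [wordRatio_cons_true, wordMap, ih, wordMap]; ring

theorem wordMap_append (lam : ℝ) (w v : List Bool) (y : ℝ) :
    wordMap lam (w ++ v) y = wordMap lam w (wordMap lam v y) := by
  induction w with
  | nil => rfl
  | cons b w ih => cases b <;> simp [wordMap, ih]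

theorem wordMap_mem_Icc {lam : ℝ} (h0 : 0 < lam) (h1 : lam < 1) (w : List Bool) {y : ℝ}
    (hy : y ∈ Icc (0 : ℝ) 1) : wordMap lam w y ∈ Icc (0 : ℝ) 1 := by
  induction w with
  | nil => exact hy
  | cons b w ih =>
    obtain ⟨h2, h3⟩ := ih
    cases b <;> constructor <;> simp only [wordMap] <;> nlinarith

theorem wordMap_mem_Ioc {lam : ℝ} (h0 : 0 < lam) (h1 : lam < 1) (w : List Bool) {y : ℝ}
    (hy : y ∈ Ioc (0 : ℝ) 1) : wordMap lam w y ∈ Ioc (0 : ℝ) 1 := by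
  refine ⟨?_, (wordMap_mem_Icc h0 h1 w (Ioc_subset_Icc_self hy)).2⟩
  rw [wordMap_eq]
  have := (wordMap_mem_Icc h0 h1 w (y := 0) (by simp)).1
  have := mul_pos (wordRatio_pos h0 h1 w) hy.1
  linarith

/-- Each application of the map cancels one letter `false` against one letter `true` standing
before it, as long as enough letters `true` precede the word. -/
theorem iterate_escMap_wordMap {lam : ℝ} (h0 : 0 < lam) (h1 : lam < 1) (w : List Bool) {y : ℝ}
    (hy : y ∈ Ioc (0 : ℝ) 1) (k : ℕ) :
    (escMap lam)^[w.count false] (lam ^ (w.count false + k) * wordMap lam w y) =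
      lam ^ (k + w.count true) * y := by
  induction w generalizing k with
  | nil => simp [wordMap]
  | cons b w ih =>
    cases b
    · have e : (false :: w).count false = w.count false + 1 := by simp
      have e' : (false :: w).count true = w.count true := by simp
      rw [e, e', Function.iterate_succ_apply, wordMap,
        show w.count false + 1 + k = w.count false + k + 1 by ring,
        escMap_pow_succ_mul h0 h1 _ (wordMap_mem_Ioc h0 h1 w hy), ih]
    · have e : (true :: w).count false = w.count false := by simp
      have e' : (true :: w).count true = w.count true + 1 := by simp
      rw [e, e', wordMap, show k + (w.count true + 1) = k + 1 + w.count true by ring, ← ih (k + 1)]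
      congr 1
      ring

/-- Cylinders of two distinct words of the same length are separated, once the part `(θ, 1]` at the
right end of each is removed. -/
theorem le_abs_wordMap_sub_wordMap {lam : ℝ} (h0 : 0 < lam) (h1 : lam < 1) {θ : ℝ}
    {v w : List Bool} (hl : v.length = w.length) (hvw : v ≠ w) {y z : ℝ}
    (hy : y ∈ Icc 0 θ) (hz : z ∈ Icc 0 θ) :
    (1 - θ) * min (wordRatio lam v) (wordRatio lam w) ≤ |wordMap lam v y - wordMap lam w z| := by
  have hl1 : 0 < 1 - lam := by linarith
  by_cases hθ : 1 < θ
  · refine le_trans ?_ (abs_nonneg _)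
    have := (lt_min (wordRatio_pos h0 h1 v) (wordRatio_pos h0 h1 w)).le
    exact mul_nonpos_of_nonpos_of_nonneg (by linarith) this
  push Not at hθ
  -- two words that differ in the first letter
  have key : ∀ (v w : List Bool) {y z : ℝ}, y ∈ Icc 0 θ → z ∈ Icc 0 θ →
      (1 - θ) * wordRatio lam (true :: v) ≤
        wordMap lam (false :: w) z - wordMap lam (true :: v) y := by
    intro v w y z hy hz
    have a := (wordMap_mem_Icc h0 h1 w ⟨hz.1, hz.2.trans hθ⟩).1
    have b := (wordMap_mem_Icc h0 h1 v (y := 1) (by simp)).2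
    rw [wordMap_eq] at b
    rw [wordRatio_cons_true, wordMap, wordMap, wordMap_eq lam v y]
    have c := mul_nonneg hl1.le a
    have d := mul_nonneg h0.le (mul_nonneg (wordRatio_pos h0 h1 v).le (sub_nonneg.2 hy.2))
    nlinarith
  induction v generalizing w with
  | nil => cases w <;> simp_all
  | cons a v ih =>
    cases w with
    | nil => simp at hl
    | cons b w =>
      simp only [List.length_cons, Nat.add_right_cancel_iff] at hl
      cases a <;> cases b
      · have := ih hl (by simpa using hvw)
        simp only [wordRatio_cons_false, wordMap]
        rw [← mul_min_of_nonneg _ _ hl1.le, show ∀ p q : ℝ, lam + (1 - lam) * p -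
          (lam + (1 - lam) * q) = (1 - lam) * (p - q) by intros; ring, abs_mul, abs_of_pos hl1,
          mul_left_comm]
        exact mul_le_mul_of_nonneg_left this hl1.le
      · refine le_trans ?_ ((key w v hz hy).trans (le_abs_self _))
        exact mul_le_mul_of_nonneg_left (min_le_right _ _) (by linarith)
      · rw [abs_sub_comm]
        refine le_trans ?_ ((key v w hy hz).trans (le_abs_self _))
        exact mul_le_mul_of_nonneg_left (min_le_left _ _) (by linarith)
      · have := ih hl (by simpa using hvw)
        simp only [wordRatio_cons_true, wordMap]
        rw [← mul_min_of_nonneg _ _ h0.le, ← mul_sub, abs_mul, abs_of_pos h0, mul_left_comm]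
        exact mul_le_mul_of_nonneg_left this h0.le

/-- There are `n.choose a` words of length `n` with exactly `a` letters `true`. -/
theorem exists_finset_words (n a : ℕ) : ∃ S : Finset (List Bool), S.card = n.choose a ∧
    ∀ w ∈ S, w.length = n ∧ w.count true = a := by
  induction n generalizing a with
  | zero =>
    cases a with
    | zero => exact ⟨{[]}, by simp⟩
    | succ a => exact ⟨∅, by simp⟩
  | succ n ih =>
    have hinj : ∀ b : Bool, Function.Injective (List.cons b) := fun b => List.cons_injective
    cases a with
    | zero =>
      obtain ⟨S, hS, hw⟩ := ih 0
      refine ⟨S.map ⟨_, hinj false⟩, by simp [hS], ?_⟩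
      simpa using hw
    | succ a =>
      obtain ⟨S, hS, hw⟩ := ih a
      obtain ⟨T, hT, hv⟩ := ih (a + 1)
      refine ⟨S.map ⟨_, hinj true⟩ ∪ T.map ⟨_, hinj false⟩, ?_, ?_⟩
      · rw [Finset.card_union_of_disjoint, Finset.card_map, Finset.card_map, hS, hT,
          Nat.choose_succ_succ]
        simp [Finset.disjoint_left]
      · intro w hw'
        simp only [Finset.mem_union, Finset.mem_map, Function.Embedding.coeFn_mk] at hw'
        rcases hw' with ⟨u, hu, rfl⟩ | ⟨u, hu, rfl⟩
        · simpa using hw u hu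
        · simpa using hv u hu

/-! ### Homogeneous Cantor sets of escaping points -/

theorem iterate_escMap_nonneg_le {lam : ℝ} (h0 : 0 < lam) (h1 : lam < 1) {x : ℝ} (hx : 0 ≤ x)
    (m : ℕ) : 0 ≤ (escMap lam)^[m] x ∧ (escMap lam)^[m] x ≤ x / (lam ^ 2) ^ m := by
  induction m with
  | zero => simpa using hx
  | succ m ih =>
    rw [Function.iterate_succ_apply']
    refine ⟨escMap_nonneg h0 h1 _, (escMap_le_div_sq h0 h1 ih.1).trans ?_⟩
    rw [pow_succ (lam ^ 2) m, ← div_div]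
    exact div_le_div_of_nonneg_right ih.2 (by positivity)

theorem tendsto_iterate_escMap_of_mul {lam : ℝ} (h0 : 0 < lam) (h1 : lam < 1) {x : ℝ}
    (hx : 0 ≤ x) {b : ℕ} (hb : 0 < b)
    (h : Tendsto (fun j => (escMap lam)^[b * j] x) atTop (𝓝 0)) :
    Tendsto (fun n => (escMap lam)^[n] x) atTop (𝓝 0) := by
  have h2 := (h.comp (Nat.tendsto_div_const_atTop hb.ne')).div_const ((lam ^ 2) ^ b)
  rw [zero_div] at h2
  refine squeeze_zero (fun n => (iterate_escMap_nonneg_le h0 h1 hx n).1) (fun n => ?_) h2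
  have h3 := (iterate_escMap_nonneg_le h0 h1 hx (b * (n / b))).1
  have h4 := (iterate_escMap_nonneg_le h0 h1 h3 (n % b)).2
  rw [← Function.iterate_add_apply, Nat.mod_add_div] at h4
  refine h4.trans (div_le_div_of_nonneg_left h3 (by positivity) ?_)
  exact pow_le_pow_of_le_one (by positivity) (pow_le_one₀ h0.le h1.le) (Nat.mod_lt n hb).le

/-- The point whose expansion is the concatenation of the words `u j ++ [false, true]`, all assumed
to have the ratio `ρ`. The end piece makes the point positive, and keeps it at a distance from the
right end of its cylinders. -/
noncomputable def codePoint (lam ρ : ℝ) (u : ℕ → List Bool) : ℝ :=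
  ∑' j, wordMap lam (u j ++ [false, true]) 0 * ρ ^ j

section codePoint

variable {lam ρ : ℝ} {u : ℕ → List Bool}

theorem wordMap_zero_mem_Icc (h0 : 0 < lam) (h1 : lam < 1) (w : List Bool) :
    wordMap lam w 0 ∈ Icc 0 (1 - wordRatio lam w) := by
  refine ⟨(wordMap_mem_Icc h0 h1 w (by simp)).1, ?_⟩
  have := (wordMap_mem_Icc h0 h1 w (y := 1) (by simp)).2
  rw [wordMap_eq] at this
  linarith

theorem wordRatio_append_lt_one (h0 : 0 < lam) (h1 : lam < 1) (w : List Bool) :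
    wordRatio lam (w ++ [false, true]) < 1 := by
  have h2 := (wordMap_zero_mem_Icc h0 h1 (w ++ [false, true])).2
  have h3 : 0 < wordMap lam (w ++ [false, true]) 0 := by
    rw [wordMap_append]
    exact (wordMap_mem_Ioc h0 h1 w (by simp [wordMap, h0, h1.le])).1
  linarith

theorem summable_codePoint (h0 : 0 < lam) (h1 : lam < 1)
    (hu : ∀ j, wordRatio lam (u j ++ [false, true]) = ρ) :
    Summable fun j => wordMap lam (u j ++ [false, true]) 0 * ρ ^ j := by
  have hρ : 0 < ρ := hu 0 ▸ wordRatio_pos h0 h1 _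
  have hρ1 : ρ < 1 := hu 0 ▸ wordRatio_append_lt_one h0 h1 _
  refine Summable.of_nonneg_of_le
    (fun j => mul_nonneg (wordMap_zero_mem_Icc h0 h1 _).1 (by positivity)) (fun j => ?_)
    ((summable_geometric_of_lt_one hρ.le hρ1).mul_left (1 - ρ))
  have := (wordMap_zero_mem_Icc h0 h1 (u j ++ [false, true])).2
  rw [hu] at this
  gcongr

theorem codePoint_succ (h0 : 0 < lam) (h1 : lam < 1)
    (hu : ∀ j, wordRatio lam (u j ++ [false, true]) = ρ) :
    codePoint lam ρ u =
      wordMap lam (u 0 ++ [false, true]) (codePoint lam ρ fun j => u (j + 1)) := by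
  rw [codePoint, (summable_codePoint h0 h1 hu).tsum_eq_zero_add,
    wordMap_eq lam _ (codePoint lam ρ _), hu, codePoint, ← tsum_mul_left, pow_zero, mul_one]
  congr 2
  ext j
  ring

theorem codePoint_mem_Ioc (h0 : 0 < lam) (h1 : lam < 1)
    (hu : ∀ j, wordRatio lam (u j ++ [false, true]) = ρ) : codePoint lam ρ u ∈ Ioc (0 : ℝ) 1 := by
  have hρ : 0 < ρ := hu 0 ▸ wordRatio_pos h0 h1 _
  have hρ1 : ρ < 1 := hu 0 ▸ wordRatio_append_lt_one h0 h1 _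
  have hI : ∀ v : ℕ → List Bool, (∀ j, wordRatio lam (v j ++ [false, true]) = ρ) →
      codePoint lam ρ v ∈ Icc (0 : ℝ) 1 := by
    intro v hv
    refine ⟨tsum_nonneg fun j =>
      mul_nonneg (wordMap_zero_mem_Icc h0 h1 _).1 (by positivity), ?_⟩
    have hs : HasSum (fun j => (1 - ρ) * ρ ^ j) 1 := by
      have := (hasSum_geometric_of_lt_one hρ.le hρ1).mul_left (1 - ρ)
      rwa [mul_inv_cancel₀ (by linarith)] at this
    rw [← hs.tsum_eq]
    refine (summable_codePoint h0 h1 hv).tsum_le_tsum (fun j => ?_) hs.summable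
    have := (wordMap_zero_mem_Icc h0 h1 (v j ++ [false, true])).2
    rw [hv] at this
    gcongr
  refine ⟨?_, (hI u hu).2⟩
  obtain ⟨h2, h3⟩ := hI _ fun j => hu (j + 1)
  rw [codePoint_succ h0 h1 hu, wordMap_append]
  refine (wordMap_mem_Ioc h0 h1 _ ⟨?_, (wordMap_mem_Icc h0 h1 _ ⟨h2, h3⟩).2⟩).1
  have := mul_nonneg (sub_nonneg.2 h1.le) (mul_nonneg h0.le h2)
  simp only [wordMap]
  linarith

end codePoint

theorem wordRatio_append_of_count {lam : ℝ} {a b : ℕ} {w : List Bool}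
    (hw : w.count true = a ∧ w.count false = b) :
    wordRatio lam (w ++ [false, true]) = lam ^ (a + 1) * (1 - lam) ^ (b + 1) := by
  simp [wordRatio, hw.1, hw.2]

theorem mul_codePoint_mem_escapingSet {lam : ℝ} (h0 : 0 < lam) (h1 : lam < 1) {a b : ℕ}
    (hab : b < a) {u : ℕ → List Bool}
    (hu : ∀ j, (u j).count true = a ∧ (u j).count false = b) :
    lam ^ (b + 1) * codePoint lam (lam ^ (a + 1) * (1 - lam) ^ (b + 1)) u ∈ escapingSet lam := by
  set ρ := lam ^ (a + 1) * (1 - lam) ^ (b + 1)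
  have hρ : ∀ k j, wordRatio lam (u (j + k) ++ [false, true]) = ρ :=
    fun k j => wordRatio_append_of_count (hu (j + k))
  have hmem : ∀ k, codePoint lam ρ (fun j => u (j + k)) ∈ Ioc (0 : ℝ) 1 :=
    fun k => codePoint_mem_Ioc h0 h1 (hρ k)
  have hx := hmem 0
  simp only [add_zero] at hx
  -- reading a block multiplies the size of the point by `lam ^ (a - b)`, up to the tail of the code
  have hit : ∀ j, (escMap lam)^[(b + 1) * j] (lam ^ (b + 1) * codePoint lam ρ u) =
      lam ^ (b + 1 + (a - b) * j) * codePoint lam ρ (fun i => u (i + j)) := by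
    intro j
    induction j with
    | zero => simp
    | succ j ih =>
      have hf : (u j ++ [false, true]).count false = b + 1 := by simp [(hu j).2]
      have ht : (u j ++ [false, true]).count true = a + 1 := by simp [(hu j).1]
      have := iterate_escMap_wordMap h0 h1 (u j ++ [false, true]) (hmem (j + 1)) ((a - b) * j)
      rw [hf, ht] at this
      rw [Nat.mul_succ, Nat.add_comm, Function.iterate_add_apply, ih, codePoint_succ h0 h1 (hρ j),
        Nat.zero_add]
      simp only [show ∀ i, i + 1 + j = i + (j + 1) by intros; ring]
      rw [this, Nat.mul_succ, show (a - b) * j + (a + 1) = b + 1 + ((a - b) * j + (a - b)) by omega]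
  have hnn : 0 ≤ lam ^ (b + 1) * codePoint lam ρ u := mul_nonneg (by positivity) hx.1.le
  refine ⟨⟨hnn, mul_le_one₀ (pow_le_one₀ h0.le h1.le) hx.1.le hx.2⟩,
    tendsto_iterate_escMap_of_mul h0 h1 hnn (Nat.succ_pos b) ?_⟩
  simp only [Nat.succ_eq_add_one, hit]
  refine squeeze_zero (fun j => mul_nonneg (by positivity) (hmem j).1.le) (fun j => ?_)
    (tendsto_pow_atTop_nhds_zero_of_lt_one h0.le h1)
  refine (mul_le_of_le_one_right (by positivity) (hmem j).2).trans
    (pow_le_pow_of_le_one h0.le h1.le ?_)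
  have := Nat.le_mul_of_pos_left j (Nat.sub_pos_of_lt hab)
  omega

/-- Codes that first differ in their `j`-th word give points at a distance of at least a constant
multiple of `ρ ^ j`. -/
theorem le_abs_codePoint_sub_codePoint {lam : ℝ} (h0 : 0 < lam) (h1 : lam < 1) {a b : ℕ} {ρ : ℝ}
    (hρ : ρ = lam ^ (a + 1) * (1 - lam) ^ (b + 1)) {j : ℕ} {u v : ℕ → List Bool}
    (hu : ∀ j, (u j).count true = a ∧ (u j).count false = b)
    (hv : ∀ j, (v j).count true = a ∧ (v j).count false = b)
    (hlt : ∀ i < j, u i = v i) (hj : u j ≠ v j) :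
    (1 - lam) ^ 2 * ρ * ρ ^ j ≤ |codePoint lam ρ u - codePoint lam ρ v| := by
  have hl : 0 < 1 - lam := by linarith
  have hρ0 : 0 < ρ := by rw [hρ]; positivity
  have hru : ∀ j, wordRatio lam (u j ++ [false, true]) = ρ := fun j => by
    rw [hρ, wordRatio_append_of_count (hu j)]
  have hrv : ∀ j, wordRatio lam (v j ++ [false, true]) = ρ := fun j => by
    rw [hρ, wordRatio_append_of_count (hv j)]
  induction j generalizing u v with
  | zero =>
    have hθ : ∀ y ∈ Ioc (0 : ℝ) 1,
        wordMap lam [false, true] y ∈ Icc 0 (lam + (1 - lam) * lam) := by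
      intro y hy
      refine ⟨(wordMap_mem_Ioc h0 h1 _ hy).1.le, ?_⟩
      simp only [wordMap]
      have := mul_le_mul_of_nonneg_left hy.2 h0.le
      nlinarith
    have hlen : (u 0).length = (v 0).length := by
      have := List.count_true_add_count_false (l := u 0)
      have := List.count_true_add_count_false (l := v 0)
      have := hu 0
      have := hv 0
      omega
    have hr : ∀ w : List Bool, w.count true = a ∧ w.count false = b → ρ ≤ wordRatio lam w := by
      rintro w ⟨rfl, rfl⟩
      rw [hρ, wordRatio]
      gcongr ?_ * ?_
      · exact pow_le_pow_of_le_one h0.le h1.le (by omega)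
      · exact pow_le_pow_of_le_one hl.le (by linarith) (by omega)
    have := le_abs_wordMap_sub_wordMap h0 h1 hlen hj
      (hθ _ (codePoint_mem_Ioc h0 h1 fun j => hru (j + 1)))
      (hθ _ (codePoint_mem_Ioc h0 h1 fun j => hrv (j + 1)))
    rw [codePoint_succ h0 h1 hru, codePoint_succ h0 h1 hrv, wordMap_append, wordMap_append,
      pow_zero, mul_one]
    refine le_trans ?_ this
    rw [show 1 - (lam + (1 - lam) * lam) = (1 - lam) ^ 2 by ring]
    exact mul_le_mul_of_nonneg_left (le_min (hr _ (hu 0)) (hr _ (hv 0))) (by positivity)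
  | succ j ih =>
    have := ih (fun i => hu (i + 1)) (fun i => hv (i + 1)) (fun i hi => hlt (i + 1) (by omega)) hj
      (fun i => hru (i + 1)) (fun i => hrv (i + 1))
    rw [codePoint_succ h0 h1 hru, codePoint_succ h0 h1 hrv, ← hlt 0 (by omega), wordMap_eq,
      wordMap_eq lam _ (codePoint lam ρ fun j => v (j + 1)), hru, add_sub_add_left_eq_sub,
      ← mul_sub, abs_mul, abs_of_pos hρ0, pow_succ]
    calc _ = ρ * ((1 - lam) ^ 2 * ρ * ρ ^ j) := by ring
      _ ≤ _ := mul_le_mul_of_nonneg_left this hρ0.le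

/-- If a parametrized set of reals maps onto `[0, 1]` in a Hölder continuous way with exponent `t`,
then its dimension is at least `t`. -/
theorem ofReal_le_dimH_range {ι : Type*} (p q : ι → ℝ) {C t : ℝ} (hC : 0 ≤ C) (ht : 0 < t)
    (hq : Icc 0 1 ⊆ range q) (h : ∀ i j, |q i - q j| ≤ C * |p i - p j| ^ t) :
    ENNReal.ofReal t ≤ dimH (range p) := by
  obtain ⟨i₀, -⟩ := hq (show (0 : ℝ) ∈ Icc 0 1 by simp)
  have : Nonempty ι := ⟨i₀⟩
  set g : ℝ → ℝ := q ∘ Function.invFun p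
  have hp : ∀ i, p (Function.invFun p (p i)) = p i := fun i => Function.invFun_eq ⟨i, rfl⟩
  have hg : ∀ i, g (p i) = q i := by
    intro i
    have := h (Function.invFun p (p i)) i
    rw [hp, sub_self, abs_zero, Real.zero_rpow ht.ne', mul_zero] at this
    exact sub_eq_zero.1 (abs_nonpos_iff.1 this)
  have hH : HolderOnWith C.toNNReal t.toNNReal g (range p) := by
    rintro _ ⟨i, rfl⟩ _ ⟨j, rfl⟩
    rw [hg, hg, edist_dist, edist_dist, Real.dist_eq, Real.dist_eq, Real.coe_toNNReal t ht.le,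
      ENNReal.ofReal_rpow_of_nonneg (abs_nonneg _) ht.le, ← ENNReal.ofReal,
      ← ENNReal.ofReal_mul hC]
    exact ENNReal.ofReal_le_ofReal (h i j)
  have ht' : 0 < t.toNNReal := Real.toNNReal_pos.2 ht
  have h2 := hH.dimH_image_le ht'
  have h3 : (1 : ENNReal) ≤ dimH (g '' range p) := by
    have : dimH (Icc (0 : ℝ) 1) = 1 := by
      rw [Real.dimH_of_nonempty_interior (by simp)]
      simp
    rw [← this]
    refine dimH_mono fun x hx => ?_
    obtain ⟨i, rfl⟩ := hq hx
    exact ⟨p i, ⟨i, rfl⟩, hg i⟩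
  have h4 := h3.trans h2
  rw [ENNReal.le_div_iff_mul_le (by simp [ht]) (by simp), one_mul] at h4
  exact h4

/-- The Cantor set built from all words with `a` letters `true` and `b < a` letters `false`
bounds the dimension of the escaping set from below. -/
theorem ofReal_le_dimH_escapingSet {lam : ℝ} (h0 : 0 < lam) (h1 : lam < 1) {t : ℝ} (ht : 0 < t)
    {a b : ℕ} (hab : b < a)
    (h : 1 ≤ (a + b).choose a * (lam ^ (a + 1) * (1 - lam) ^ (b + 1)) ^ t) :
    ENNReal.ofReal t ≤ dimH (escapingSet lam) := by
  have hl : 0 < 1 - lam := by linarith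
  obtain ⟨S, hS, hSw⟩ := exists_finset_words (a + b) a
  set M := (a + b).choose a
  set ρ := lam ^ (a + 1) * (1 - lam) ^ (b + 1) with hρ
  have hρ0 : 0 < ρ := by positivity
  have hρ1 : ρ < 1 := by
    refine mul_lt_one_of_nonneg_of_lt_one_left (by positivity) (pow_lt_one₀ h0.le h1 (by omega)) ?_
    exact pow_le_one₀ hl.le (by linarith)
  have hM : 1 < M := by
    by_contra hM
    have : (M : ℝ) ≤ 1 := by exact_mod_cast not_lt.1 hM
    have h2 := Real.rpow_lt_one hρ0.le hρ1 ht
    have h3 : 0 < ρ ^ t := by positivity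
    nlinarith
  let e : Fin M ≃ S := (finCongr hS.symm).trans S.equivFin.symm
  have hw : ∀ i, ((e i : List Bool).count true = a ∧ (e i : List Bool).count false = b) := by
    intro i
    have h2 := hSw _ (e i).2
    have := List.count_true_add_count_false (l := (e i : List Bool))
    omega
  set κ := lam ^ (b + 1) * ((1 - lam) ^ 2 * ρ)
  have hκ : 0 < κ := by positivity
  let p : (ℕ → Fin M) → ℝ := fun D => lam ^ (b + 1) * codePoint lam ρ fun j => e (D j)
  refine (ofReal_le_dimH_range p (Real.ofDigits (b := M)) (C := (κ⁻¹) ^ t) (by positivity) ht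
    (fun x hx => ?_) fun D E => ?_).trans (dimH_mono ?_)
  · obtain ⟨D, -, hD⟩ := Real.ofDigits_SurjOn hM hx
    exact ⟨D, hD⟩
  · by_cases hDE : D = E
    · subst hDE
      rw [sub_self, abs_zero]
      positivity
    have hex : ∃ j, D j ≠ E j := Function.ne_iff.1 hDE
    classical
    set j := Nat.find hex
    have hlt : ∀ i < j, D i = E i := fun i hi => not_not.1 (Nat.find_min hex hi)
    have h2 := le_abs_codePoint_sub_codePoint h0 h1 hρ (j := j) (u := fun j => e (D j))
      (v := fun j => e (E j)) (fun i => hw _) (fun i => hw _)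
      (fun i hi => by simp only [hlt i hi])
      (fun hh => Nat.find_spec hex (e.injective (Subtype.ext hh)))
    have h3 : κ * ρ ^ j ≤ |p D - p E| := by
      rw [← mul_sub, abs_mul, abs_of_pos (by positivity : 0 < lam ^ (b + 1)), mul_assoc]
      exact mul_le_mul_of_nonneg_left h2 (by positivity)
    have hM0 : (0 : ℝ) < M := by exact_mod_cast (by omega : 0 < M)
    calc |Real.ofDigits D - Real.ofDigits E| ≤ ((M : ℝ) ^ j)⁻¹ :=
          Real.abs_ofDigits_sub_ofDigits_le hlt
      _ ≤ (ρ ^ t) ^ j := by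
          rw [← inv_pow]
          gcongr
          rw [inv_le_iff_one_le_mul₀' hM0]
          exact h
      _ = (ρ ^ j) ^ t := by
          rw [← Real.rpow_natCast, ← Real.rpow_mul hρ0.le, mul_comm, Real.rpow_mul hρ0.le,
            Real.rpow_natCast]
      _ ≤ (κ⁻¹ * |p D - p E|) ^ t := by
          gcongr
          rwa [← div_eq_inv_mul, le_div_iff₀' hκ]
      _ = κ⁻¹ ^ t * |p D - p E| ^ t := Real.mul_rpow (by positivity) (abs_nonneg _)
  · rintro _ ⟨D, rfl⟩
    exact mul_codePoint_mem_escapingSet h0 h1 hab fun j => hw _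

/-! ### Counting words -/

/-- Words of length `2 * m + 1` with `m + 1` letters `true` are numerous enough for every exponent
below `log 4 / -log (lam * (1 - lam))`. -/
theorem exists_central_words {lam : ℝ} (h0 : 0 < lam) (h1 : lam < 1) {t : ℝ}
    (ht : 1 < 4 * (lam * (1 - lam)) ^ t) : ∃ a b : ℕ, b < a ∧
      1 ≤ (a + b).choose a * (lam ^ (a + 1) * (1 - lam) ^ (b + 1)) ^ t := by
  have hl : 0 < 1 - lam := by linarith
  set r := lam * (1 - lam) with hr
  have hr0 : 0 < r := by positivity
  obtain ⟨m, hm, hm0⟩ := (((tendsto_pow_const_div_const_pow_of_one_lt 1 ht).eventually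
    (gt_mem_nhds (by positivity : 0 < (lam * r) ^ t / 2))).and (eventually_gt_atTop 0)).exists
  refine ⟨m + 1, m, Nat.lt_succ_self m, ?_⟩
  have hc : (4 : ℝ) ^ m ≤ 2 * m * (m + 1 + m).choose (m + 1) := by
    have h2 := Nat.four_pow_le_two_mul_self_mul_centralBinom m hm0
    have h3 : m.centralBinom ≤ (m + 1 + m).choose (m + 1) := by
      rw [Nat.centralBinom_eq_two_mul_choose, show m + 1 + m = 2 * m + 1 by ring,
        Nat.choose_symm_half]
      exact Nat.choose_le_choose m (Nat.le_succ _)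
    exact_mod_cast h2.trans (Nat.mul_le_mul_left _ h3)
  have he : (lam ^ (m + 1 + 1) * (1 - lam) ^ (m + 1)) ^ t = (r ^ t) ^ m * (lam * r) ^ t := by
    rw [Real.rpow_pow_comm hr0.le, ← Real.mul_rpow (by positivity) (by positivity), hr, mul_pow]
    congr 1
    ring
  rw [he]
  rw [pow_one, div_lt_iff₀ (by positivity), mul_pow] at hm
  have hm' : (0 : ℝ) < m := by exact_mod_cast hm0
  have hx : 0 < (r ^ t) ^ m * (lam * r) ^ t := by positivity
  have h5 := mul_le_mul_of_nonneg_right hc hx.le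
  have h6 : 2 * (m : ℝ) * 1 ≤
      2 * m * ((m + 1 + m).choose (m + 1) * ((r ^ t) ^ m * (lam * r) ^ t)) := by
    nlinarith
  exact le_of_mul_le_mul_left h6 (by positivity)

/-- For `lam > 1 / 2`, most of the mass of the binomial distribution with parameter `lam` is on
words with more letters `true` than `false`. Hence for every exponent below `1` some number of
letters `true` has sufficiently many words. -/
theorem exists_majority_words {lam : ℝ} (h0 : 1 / 2 < lam) (h1 : lam < 1) {t : ℝ} (ht : t < 1) :
    ∃ a b : ℕ, b < a ∧ 1 ≤ (a + b).choose a * (lam ^ (a + 1) * (1 - lam) ^ (b + 1)) ^ t := by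
  have hp : 0 < lam := by linarith
  have hl : 0 < 1 - lam := by linarith
  by_contra! hcon
  set r := lam * (1 - lam) with hr
  have hr0 : 0 < r := by positivity
  have hr1 : 4 * r < 1 := by nlinarith [mul_pos (sub_pos.2 h0) (sub_pos.2 h0)]
  set κ := (lam ^ 2) ^ (1 - t) with hκ
  have hκ0 : 0 < κ := by positivity
  have hκ1 : κ < 1 := Real.rpow_lt_one (by positivity) (pow_lt_one₀ hp.le h1 two_ne_zero)
    (by linarith)
  -- if all majority words of length `2 * m` are too few, the binomial expansion of
  -- `(lam + (1 - lam)) ^ (2 * m) = 1` is bounded by a sequence that tends to `0`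
  have hbound : ∀ m : ℕ, (1 : ℝ) ≤ (4 * r) ^ m + (2 * (m * κ ^ m) + κ ^ m) / r := by
    intro m
    have hterm : ∀ j ∈ Finset.range (2 * m + 1),
        lam ^ j * (1 - lam) ^ (2 * m - j) * (2 * m).choose j ≤
          r ^ m * (2 * m).choose j + κ ^ m / r := by
      intro j hj
      rw [Finset.mem_range] at hj
      by_cases hjm : j ≤ m
      · -- minority words have ratio at most `r ^ m`
        have : lam ^ j * (1 - lam) ^ (2 * m - j) ≤ r ^ m := by
          rw [show 2 * m - j = (m - j) + m by omega, pow_add, hr, mul_pow,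
            show lam ^ m = lam ^ j * lam ^ (m - j) by rw [← pow_add]; congr 1; omega, ← mul_assoc]
          gcongr
          linarith
        have h3 : 0 ≤ κ ^ m / r := by positivity
        have := mul_le_mul_of_nonneg_right this (Nat.cast_nonneg (α := ℝ) ((2 * m).choose j))
        linarith
      · have h2 := hcon j (2 * m - j) (by omega)
        rw [show j + (2 * m - j) = 2 * m by omega] at h2
        set ρ := lam ^ (j + 1) * (1 - lam) ^ (2 * m - j + 1) with hρ
        have hρ0 : 0 < ρ := by positivity
        have h3 : ρ ≤ (lam ^ 2) ^ m := by
          calc ρ ≤ lam ^ j * lam ^ (2 * m - j) := by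
                rw [hρ]
                gcongr ?_ * ?_
                · exact pow_le_pow_of_le_one hp.le h1.le (by omega)
                · refine (pow_le_pow_of_le_one hl.le (by linarith) (Nat.le_succ _)).trans ?_
                  gcongr
                  linarith
            _ = (lam ^ 2) ^ m := by rw [← pow_add, ← pow_mul]; congr 1; omega
        have h4 : ρ ^ (1 - t) ≤ κ ^ m := by
          calc ρ ^ (1 - t) ≤ ((lam ^ 2) ^ m) ^ (1 - t) :=
                Real.rpow_le_rpow hρ0.le h3 (by linarith)
            _ = κ ^ m := (Real.rpow_pow_comm (by positivity) _ _).symm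
        have h5 : ρ = ρ ^ t * ρ ^ (1 - t) := by
          rw [← Real.rpow_add hρ0, add_sub_cancel, Real.rpow_one]
        have h6 : lam ^ j * (1 - lam) ^ (2 * m - j) * (2 * m).choose j =
            (2 * m).choose j * ρ / r := by
          rw [eq_div_iff hr0.ne', hρ, hr, pow_succ, pow_succ]
          ring
        have h7 : (2 * m).choose j * ρ ≤ κ ^ m := by
          rw [h5, ← mul_assoc]
          have := mul_le_mul h2.le h4 (by positivity) zero_le_one
          linarith
        rw [h6]
        have h8 : 0 ≤ r ^ m * ((2 * m).choose j : ℝ) := by positivity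
        have h9 := div_le_div_of_nonneg_right h7 hr0.le
        linarith
    have hs := Finset.sum_le_sum hterm
    rw [← add_pow, add_sub_cancel, one_pow, Finset.sum_add_distrib, ← Finset.mul_sum,
      ← Nat.cast_sum, Nat.sum_range_choose, Finset.sum_const, Finset.card_range, nsmul_eq_mul,
      pow_mul] at hs
    push_cast at hs
    calc (1 : ℝ) ≤ _ := hs
      _ = _ := by rw [mul_pow 4 r]; ring
  have hlim : Tendsto (fun m : ℕ => (4 * r) ^ m + (2 * (m * κ ^ m) + κ ^ m) / r) atTop (𝓝 0) := by
    have hk := tendsto_pow_atTop_nhds_zero_of_lt_one hκ0.le hκ1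
    have h2 := tendsto_self_mul_const_pow_of_lt_one hκ0.le hκ1
    simpa using (tendsto_pow_atTop_nhds_zero_of_lt_one (by positivity) hr1).add
      (((h2.const_mul 2).add hk).div_const r)
  exact absurd (ge_of_tendsto' hlim hbound) (by norm_num)

/-! ### Efficient covers -/

/-- The set `A` has a countable cover by sets of diameter at most `δ`, with sum of the `s`-th powers
of the diameters at most `B`. -/
def HasCover (s : ℝ) (δ B : ENNReal) (A : Set ℝ) : Prop :=
  ∃ U : ℕ → Set ℝ, A ⊆ ⋃ i, U i ∧ (∀ i, Metric.ediam (U i) ≤ δ) ∧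
    ∑' i, Metric.ediam (U i) ^ s ≤ B

namespace HasCover

variable {s : ℝ} {δ B : ENNReal}

theorem mono {B' : ENNReal} {A A' : Set ℝ} (h : HasCover s δ B A) (hA : A' ⊆ A) (hB : B ≤ B') :
    HasCover s δ B' A' := by
  obtain ⟨U, h2, h3, h4⟩ := h
  exact ⟨U, hA.trans h2, h3, h4.trans hB⟩

theorem of_ediam_le (hs : 0 < s) {A : Set ℝ} (h : Metric.ediam A ≤ δ)
    (hB : Metric.ediam A ^ s ≤ B) : HasCover s δ B A := by
  refine ⟨fun i => if i = 0 then A else ∅, fun x hx => mem_iUnion.2 ⟨0, by simpa using hx⟩,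
    fun i => ?_, ?_⟩
  · dsimp only
    split_ifs
    · exact h
    · simp
  · rw [tsum_eq_single 0]
    · simpa using hB
    · intro i hi
      simp [hi, ENNReal.zero_rpow_of_pos hs]

theorem iUnion {B : ℕ → ENNReal} {A : ℕ → Set ℝ} (h : ∀ i, HasCover s δ (B i) (A i)) :
    HasCover s δ (∑' i, B i) (⋃ i, A i) := by
  choose U hU hd hs using h
  refine ⟨fun k => U k.unpair.1 k.unpair.2, iUnion_subset fun i x hx => ?_, fun k => hd _ _, ?_⟩
  · obtain ⟨j, hj⟩ := mem_iUnion.1 (hU i hx)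
    exact mem_iUnion.2 ⟨Nat.pair i j, by simpa using hj⟩
  · have := Nat.pairEquiv.symm.tsum_eq fun p : ℕ × ℕ => Metric.ediam (U p.1 p.2) ^ s
    simp only [Nat.pairEquiv_symm_apply] at this
    rw [this, ENNReal.tsum_prod']
    exact ENNReal.tsum_le_tsum hs

theorem image (hs : 0 ≤ s) {A : Set ℝ} (h : HasCover s δ B A) {K : NNReal} {f : ℝ → ℝ}
    (hf : LipschitzWith K f) : HasCover s (K * δ) ((K : ENNReal) ^ s * B) (f '' A) := by
  obtain ⟨U, h2, h3, h4⟩ := h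
  have hd : ∀ i, Metric.ediam (f '' U i) ≤ K * Metric.ediam (U i) := fun i =>
    hf.ediam_image_le _
  refine ⟨fun i => f '' U i, ?_, fun i => (hd i).trans (by gcongr; exact h3 i), ?_⟩
  · rw [← image_iUnion]
    exact image_mono h2
  · calc ∑' i, Metric.ediam (f '' U i) ^ s ≤ ∑' i, (K : ENNReal) ^ s * Metric.ediam (U i) ^ s := by
          refine ENNReal.tsum_le_tsum fun i => ?_
          rw [← ENNReal.mul_rpow_of_nonneg _ _ hs]
          exact ENNReal.rpow_le_rpow (hd i) hs
      _ ≤ _ := by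
          rw [ENNReal.tsum_mul_left]
          gcongr

theorem dimH_le {s : NNReal} {A : Set ℝ} {δ : ℕ → ENNReal} (hδ : Tendsto δ atTop (𝓝 0))
    (hB : B ≠ ⊤) (h : ∀ k, HasCover s (δ k) B A) : dimH A ≤ s := by
  choose U hU hd hs using h
  refine dimH_le_of_hausdorffMeasure_ne_top (ne_top_of_le_ne_top hB ?_)
  refine (MeasureTheory.Measure.hausdorffMeasure_le_liminf_tsum s A δ hδ U
    (Eventually.of_forall hd) (Eventually.of_forall hU)).trans ?_
  exact liminf_le_of_le (by isBoundedDefault) fun b hb => by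
    obtain ⟨k, hk⟩ := hb.exists
    exact hk.trans (hs k)

end HasCover

/-! ### The upper bound -/

theorem escMap_mem_Ioc {lam : ℝ} (h0 : 0 < lam) (h1 : lam < 1) {x : ℝ} (hx : x ∈ Ioc (0 : ℝ) 1) :
    escMap lam x ∈ Ioc (0 : ℝ) 1 := by
  have hl : 0 < 1 - lam := by linarith
  obtain ⟨n, hn, hxn⟩ := exists_mem_partInterval h0 h1 hx
  obtain ⟨h2, h3⟩ := hxn
  obtain rfl | hn2 := hn.eq_or_lt
  · rw [escMap_of_mem_one ⟨h2, h3⟩]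
    rw [pow_one] at h2
    exact ⟨div_pos (by linarith) hl, (div_le_one hl).2 (by linarith [hx.2])⟩
  · rw [escMap_of_mem h0 h1 hn2 ⟨h2, h3⟩]
    refine ⟨div_pos (by linarith) (by positivity), (div_le_one (by positivity)).2 ?_⟩
    obtain ⟨m, rfl⟩ : ∃ m, n = m + 2 := ⟨n - 2, by omega⟩
    rw [show m + 2 - 1 = m + 1 by omega] at h3
    have h4 : lam ^ m * (lam * (1 - lam)) ≤ 1 * (lam * (1 - lam)) :=
      mul_le_mul_of_nonneg_right (pow_le_one₀ h0.le h1.le) (by positivity)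
    calc x - lam ^ (m + 2) ≤ lam ^ (m + 1) - lam ^ (m + 2) := by linarith
      _ = lam ^ m * (lam * (1 - lam)) := by ring
      _ ≤ lam * (1 - lam) := by linarith

/-- The map is piecewise similar on countably many pieces, so preimages do not increase the
dimension. -/
theorem dimH_preimage_escMap_le {lam : ℝ} (h0 : 0 < lam) (h1 : lam < 1) (A : Set ℝ) :
    dimH {x | x ∈ Ioc (0 : ℝ) 1 ∧ escMap lam x ∈ A} ≤ dimH A := by
  have hl : 0 < 1 - lam := by linarith
  have hsub : {x | x ∈ Ioc (0 : ℝ) 1 ∧ escMap lam x ∈ A} ⊆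
      ⋃ p : ℕ × Bool, (fun y => lam ^ p.1 + (bif p.2 then 1 - lam else lam * (1 - lam)) * y) '' A := by
    rintro x ⟨hx, hxA⟩
    obtain ⟨n, hn, hxn⟩ := exists_mem_partInterval h0 h1 hx
    refine mem_iUnion.2 ?_
    obtain rfl | hn2 := hn.eq_or_lt
    · refine ⟨(1, true), _, hxA, ?_⟩
      rw [escMap_of_mem_one hxn]
      simp only [cond_true]
      field_simp
      ring
    · refine ⟨(n, false), _, hxA, ?_⟩
      rw [escMap_of_mem h0 h1 hn2 hxn]
      simp only [cond_false]
      field_simp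
      ring
  refine (dimH_mono hsub).trans ?_
  rw [dimH_iUnion]
  refine iSup_le fun p => LipschitzWith.dimH_image_le (LipschitzWith.of_dist_le_mul
    (K := ‖(bif p.2 then 1 - lam else lam * (1 - lam) : ℝ)‖₊) fun x y => ?_) A
  rw [Real.dist_eq, Real.dist_eq, add_sub_add_left_eq_sub, ← mul_sub, abs_mul]
  rfl

/-- The points whose orbit never enters the first interval `(lam, 1]`. -/
def lowSet (lam : ℝ) : Set ℝ :=
  {x | ∀ k : ℕ, (escMap lam)^[k] x ∈ Ioc 0 lam}

theorem dimH_escapingSet_le_dimH_lowSet {lam : ℝ} (h0 : 0 < lam) (h1 : lam < 1) :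
    dimH (escapingSet lam) ≤ dimH (lowSet lam) := by
  have hN : ∀ N : ℕ, dimH {x | x ∈ Ioc (0 : ℝ) 1 ∧ (escMap lam)^[N] x ∈ lowSet lam} ≤
      dimH (lowSet lam) := by
    intro N
    induction N with
    | zero => exact dimH_mono fun x hx => hx.2
    | succ N ih =>
      refine (dimH_mono fun x hx => ?_).trans ((dimH_preimage_escMap_le h0 h1 _).trans ih)
      exact ⟨hx.1, escMap_mem_Ioc h0 h1 hx.1, hx.2⟩
  have hsub : escapingSet lam ⊆
      {0} ∪ ⋃ N : ℕ, {x | x ∈ Ioc (0 : ℝ) 1 ∧ (escMap lam)^[N] x ∈ lowSet lam} := by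
    rintro x ⟨hx, hlim⟩
    obtain hx0 | hx0 := hx.1.eq_or_lt
    · exact Or.inl hx0.symm
    · right
      obtain ⟨N, hN⟩ := eventually_atTop.1 (hlim.eventually (gt_mem_nhds h0))
      refine mem_iUnion.2 ⟨N, ⟨hx0, hx.2⟩, fun k => ?_⟩
      rw [← Function.iterate_add_apply]
      refine ⟨?_, (hN _ (Nat.le_add_left N k)).le⟩
      have hmaps : MapsTo (escMap lam) (Ioc 0 1) (Ioc 0 1) := fun y hy => escMap_mem_Ioc h0 h1 hy
      exact (hmaps.iterate (k + N) ⟨hx0, hx.2⟩).1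
  refine (dimH_mono hsub).trans ?_
  rw [dimH_union, dimH_singleton, dimH_iUnion]
  exact max_le zero_le (iSup_le hN)

theorem lowSet_inter_partInterval_subset {lam : ℝ} (h0 : 0 < lam) (h1 : lam < 1) (m : ℕ) :
    lowSet lam ∩ partInterval lam (m + 2) ⊆
      ⋃ i : ℕ, (fun y => lam ^ (m + 2) + lam * (1 - lam) * y) ''
        (lowSet lam ∩ partInterval lam (m + i + 1)) := by
  have hl : 0 < 1 - lam := by linarith
  rintro x ⟨hx, hxm⟩
  have hy : escMap lam x ∈ lowSet lam := fun k => hx (k + 1)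
  have he := escMap_of_mem h0 h1 (by omega) hxm
  have hyx : lam ^ (m + 2) + lam * (1 - lam) * escMap lam x = x := by
    rw [he]
    field_simp
    ring
  have hym : escMap lam x ≤ lam ^ m := by
    have h2 : x ≤ lam ^ (m + 1) := hxm.2
    refine le_of_mul_le_mul_left (a := lam * (1 - lam)) ?_ (by positivity)
    calc lam * (1 - lam) * escMap lam x = x - lam ^ (m + 2) := by linarith
      _ ≤ lam ^ (m + 1) - lam ^ (m + 2) := by linarith
      _ = lam * (1 - lam) * lam ^ m := by ring
  obtain ⟨n, hn, hyn⟩ := exists_mem_partInterval h0 h1 ⟨(hy 0).1, (hy 0).2.trans h1.le⟩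
  have hmn : m < n := (pow_lt_pow_iff_right_of_lt_one₀ h0 h1).1 (hyn.1.trans_le hym)
  refine mem_iUnion.2 ⟨n - (m + 1), _, ⟨hy, ?_⟩, hyx⟩
  rwa [show m + (n - (m + 1)) + 1 = n by omega]

/-- The weight `2⁻¹ ^ m` is invariant under the transfer operator with exponent `s`, because
`∑ i, 4⁻¹ * 2⁻¹ ^ (m + i) = 2⁻¹ ^ (m + 1)`. -/
theorem hasCover_lowSet {lam : ℝ} (h0 : 0 < lam) (h1 : lam ≤ 1 / 2) {s : ℝ} (hs : 0 < s)
    (hr : (lam * (1 - lam)) ^ s = 1 / 4) (k m : ℕ) :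
    HasCover s (ENNReal.ofReal (lam * (1 - lam)) ^ k) (2⁻¹ ^ m)
      (lowSet lam ∩ partInterval lam (m + 1)) := by
  have h1' : lam < 1 := by linarith
  have hl : 0 < 1 - lam := by linarith
  induction k generalizing m with
  | zero =>
    have hd : Metric.ediam (lowSet lam ∩ partInterval lam (m + 1)) ≤ ENNReal.ofReal (lam ^ m) := by
      refine (Metric.ediam_mono (inter_subset_right.trans Ioc_subset_Icc_self)).trans ?_
      rw [Real.ediam_Icc, Nat.add_sub_cancel]
      exact ENNReal.ofReal_le_ofReal (by linarith [pow_pos h0 (m + 1)])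
    refine HasCover.of_ediam_le hs (hd.trans ?_) ((ENNReal.rpow_le_rpow hd hs.le).trans ?_)
    · rw [pow_zero, ENNReal.ofReal_le_one]
      exact pow_le_one₀ h0.le h1'.le
    · -- `lam ^ s ≤ 1 / 2`, since `lam ^ 2 ≤ lam * (1 - lam)`
      have h2 : lam ^ s ≤ 1 / 2 := by
        have h3 : (lam ^ s) ^ 2 ≤ 1 / 4 := by
          rw [← hr, Real.rpow_pow_comm h0.le]
          exact Real.rpow_le_rpow (by positivity) (by nlinarith) hs.le
        have : 0 < lam ^ s := by positivity
        nlinarith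
      have h4 : (lam ^ m) ^ s ≤ (1 / 2 : ℝ) ^ m := by
        rw [← Real.rpow_pow_comm h0.le]
        gcongr
      rw [ENNReal.ofReal_rpow_of_pos (by positivity)]
      refine (ENNReal.ofReal_le_ofReal h4).trans ?_
      rw [ENNReal.ofReal_pow (by norm_num), one_div, ENNReal.ofReal_inv_of_pos (by norm_num)]
      norm_num
  | succ k ih =>
    cases m with
    | zero =>
      have he : lowSet lam ∩ partInterval lam (0 + 1) = ∅ := by
        rw [eq_empty_iff_forall_notMem]
        rintro x ⟨hx, hx1⟩
        have h2 := (hx 0).2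
        have h3 := hx1.1
        rw [zero_add, pow_one] at h3
        exact absurd h2 (not_le.2 h3)
      rw [he]
      exact HasCover.of_ediam_le hs (by simp) (by simp [ENNReal.zero_rpow_of_pos hs])
    | succ m =>
      have hf : LipschitzWith (lam * (1 - lam)).toNNReal
          (fun y => lam ^ (m + 2) + lam * (1 - lam) * y) := by
        refine LipschitzWith.of_dist_le_mul fun x y => ?_
        rw [Real.dist_eq, Real.dist_eq, add_sub_add_left_eq_sub, ← mul_sub, abs_mul,
          Real.coe_toNNReal _ (by positivity), abs_of_pos (by positivity : 0 < lam * (1 - lam))]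
      have h2 := HasCover.iUnion fun i => (ih (m + i)).image hs.le hf
      rw [pow_succ, mul_comm]
      refine h2.mono (lowSet_inter_partInterval_subset h0 h1' m) (le_of_eq ?_)
      have h4 : ((lam * (1 - lam)).toNNReal : ENNReal) ^ s = 2⁻¹ * 2⁻¹ := by
        rw [← ENNReal.ofReal, ENNReal.ofReal_rpow_of_pos (by positivity), hr,
          show (1 / 4 : ℝ) = 2⁻¹ * 2⁻¹ by norm_num, ENNReal.ofReal_mul (by norm_num),
          ENNReal.ofReal_inv_of_pos (by norm_num)]
        norm_num
      simp only [h4, pow_add]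
      rw [ENNReal.tsum_mul_left, ENNReal.tsum_mul_left, ENNReal.tsum_geometric,
        ENNReal.one_sub_inv_two, inv_inv, pow_one, mul_comm (2⁻¹ ^ m), ← mul_assoc,
        mul_assoc (2⁻¹ : ENNReal) 2⁻¹ 2, ENNReal.inv_mul_cancel (by norm_num) (by norm_num)]
      ring

theorem dimH_escapingSet_le {lam : ℝ} (h0 : 0 < lam) (h1 : lam ≤ 1 / 2) {s : ℝ} (hs : 0 < s)
    (hr : (lam * (1 - lam)) ^ s = 1 / 4) : dimH (escapingSet lam) ≤ ENNReal.ofReal s := by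
  have h1' : lam < 1 := by linarith
  refine (dimH_escapingSet_le_dimH_lowSet h0 h1').trans ?_
  have hsub : lowSet lam ⊆ ⋃ m : ℕ, lowSet lam ∩ partInterval lam (m + 1) := by
    intro x hx
    obtain ⟨n, hn, hxn⟩ := exists_mem_partInterval h0 h1' ⟨(hx 0).1, (hx 0).2.trans h1'.le⟩
    exact mem_iUnion.2 ⟨n - 1, hx, by rwa [Nat.sub_add_cancel hn]⟩
  refine (dimH_mono hsub).trans ?_
  rw [dimH_iUnion]
  refine iSup_le fun m => HasCover.dimH_le (B := 2⁻¹ ^ m)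
    (δ := fun k => ENNReal.ofReal (lam * (1 - lam)) ^ k)
    (ENNReal.tendsto_pow_atTop_nhds_zero_of_lt_one ?_) (by simp) fun k => ?_
  · rw [ENNReal.ofReal_lt_one]
    nlinarith
  · rw [Real.coe_toNNReal s hs.le]
    exact hasCover_lowSet h0 h1 hs hr k m

/-! ### The dimension formula -/

theorem ofReal_le_of_forall_lt {s : ℝ} {D : ENNReal}
    (h : ∀ t, 0 < t → t < s → ENNReal.ofReal t ≤ D) : ENNReal.ofReal s ≤ D := by
  refine le_of_forall_lt_imp_le_of_dense fun c hc => ?_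
  have hct : c ≠ ⊤ := ne_top_of_lt hc
  obtain h2 | h2 := (ENNReal.toReal_nonneg (a := c)).eq_or_lt
  · rw [(ENNReal.toReal_eq_zero_iff c).1 h2.symm |>.resolve_right hct]
    exact zero_le
  · have := h _ h2 ((ENNReal.lt_ofReal_iff_toReal_lt hct).1 hc)
    rwa [ENNReal.ofReal_toReal hct] at this

theorem mainTheorem9 (lam : ℝ) (h0 : 0 < lam) (h1 : lam < 1) :
    (lam ≤ 1 / 2 →
      dimH (escapingSet lam) = ENNReal.ofReal (-Real.log 4 / Real.log (lam * (1 - lam)))) ∧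
    (1 / 2 ≤ lam → dimH (escapingSet lam) = 1) := by
  have hl : 0 < 1 - lam := by linarith
  have hr0 : 0 < lam * (1 - lam) := by positivity
  have hr1 : lam * (1 - lam) < 1 := by nlinarith
  have hlog : Real.log (lam * (1 - lam)) < 0 := Real.log_neg hr0 hr1
  have hlog4 : 0 < Real.log 4 := Real.log_pos (by norm_num)
  set s := -Real.log 4 / Real.log (lam * (1 - lam)) with hs
  have hs0 : 0 < s := div_pos_of_neg_of_neg (by linarith) hlog
  have hrs : (lam * (1 - lam)) ^ s = 1 / 4 := by
    rw [Real.rpow_def_of_pos hr0, hs, mul_div_cancel₀ _ hlog.ne, Real.exp_neg,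
      Real.exp_log (by norm_num), one_div]
  have hlow : ENNReal.ofReal s ≤ dimH (escapingSet lam) := by
    refine ofReal_le_of_forall_lt fun t ht hts => ?_
    have h2 := Real.rpow_lt_rpow_of_exponent_gt hr0 hr1 hts
    obtain ⟨a, b, hab, h3⟩ := exists_central_words h0 h1 (t := t) (by linarith)
    exact ofReal_le_dimH_escapingSet h0 h1 ht hab h3
  refine ⟨fun h => le_antisymm (dimH_escapingSet_le h0 h hs0 hrs) hlow, fun h => ?_⟩
  refine le_antisymm ((dimH_mono (subset_univ _)).trans Real.dimH_univ.le) ?_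
  obtain rfl | h := h.eq_or_lt
  · have : s = 1 := by
      rw [hs, show (1 / 2 : ℝ) * (1 - 1 / 2) = 4⁻¹ by norm_num, Real.log_inv, div_self]
      linarith
    rwa [this, ENNReal.ofReal_one] at hlow
  · rw [← ENNReal.ofReal_one]
    refine ofReal_le_of_forall_lt fun t ht ht1 => ?_
    obtain ⟨a, b, hab, h3⟩ := exists_majority_words h h1 ht1
    exact ofReal_le_dimH_escapingSet h0 h1 ht hab h3
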